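/- Let $G$ be a (discrete) group, acting on itself by left multiplication. The following conditions are equivalent: 1. $G$ is locally finite, i.e. every finitely generated subgroup of $G$ is finite; 2. the uniform Roe algebra $\ell^\infty(G)\rtimes_{\mathrm r}G$ (the reduced crossed product of $\ell^\infty(G)$ by the left translation action of $G$) is finite, i.e. every $v\in \ell^\infty(G)\rtimes_{\mathrm r}G$ with $v^*v=1$ satisfies $vv^*=1$; 3. $G$ is not equidecomposable with a proper subset of itself; 4. no subset $A\subseteq G$ is equidecomposable with a proper subset of itself; 5. there is no injective uniform embedding from $\mathbb Z$ into $G$. Here two subsets $A,B\subseteq G$ are equidecomposable if there are finite partitions $\{A_i\}_{i=1}^n$ of $A$ and $\{B_i\}_{i=1}^n$ of $B$ and elements $s_1,\dots,s_n\in G$ with $B_i=s_iA_i$ for all $i$. A map $f\colon H\to G$ between groups is a uniform embedding if for every finite $S\subseteq H$ there is a finite $T\subseteq G$ such that, for all $x,y\in H$, $xy^{-1}\in S$ implies $f(x)f(y)^{-1}\in T$, and for every finite $T\subseteq G$ there is a finite $S\subseteq H$ such that, for all $x,y\in H$, $f(x)f(y)^{-1}\in T$ implies $xy^{-1}\in S$.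 -/

import Mathlib

open scoped ENNReal Pointwise

noncomputable section

namespace UniformRoe

/-- A group is locally finite if each of its finitely generated subgroups is finite. -/
def IsLocallyFiniteGroup (G : Type*) [Group G] : Prop :=
  ∀ H : Subgroup G, H.FG → (H : Set G).Finite

/-- Subsets `A` and `B` of a `G`-set `X` are equidecomposable if there are finite partitions
`A = A₁ ⊔ ⋯ ⊔ Aₙ` and `B = B₁ ⊔ ⋯ ⊔ Bₙ` and `s₁, …, sₙ ∈ G` with `Bᵢ = sᵢ Aᵢ` for all `i`. -/
def Equidecomposable (G : Type*) {X : Type*} [Group G] [MulAction G X] (A B : Set X) : Prop :=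
  ∃ (n : ℕ) (P Q : Fin n → Set X) (s : Fin n → G),
    (Pairwise fun i j => Disjoint (P i) (P j)) ∧ (⋃ i, P i) = A ∧
    (Pairwise fun i j => Disjoint (Q i) (Q j)) ∧ (⋃ i, Q i) = B ∧
    ∀ i, Q i = s i • P i

/-- A map `f : H → G` between groups is a uniform embedding if for every finite `S ⊆ H` there is a
finite `T ⊆ G` such that `x y⁻¹ ∈ S` implies `f x (f y)⁻¹ ∈ T`, and for every finite `T ⊆ G` there
is a finite `S ⊆ H` such that `f x (f y)⁻¹ ∈ T` implies `x y⁻¹ ∈ S`. -/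
def IsGroupUniformEmbedding {H G : Type*} [Group H] [Group G] (f : H → G) : Prop :=
  (∀ S : Set H, S.Finite → ∃ T : Set G, T.Finite ∧
    ∀ x y : H, x * y⁻¹ ∈ S → f x * (f y)⁻¹ ∈ T) ∧
  (∀ T : Set G, T.Finite → ∃ S : Set H, S.Finite ∧
    ∀ x y : H, f x * (f y)⁻¹ ∈ T → x * y⁻¹ ∈ S)

/-- A unital C⋆-algebra is finite if each of its isometries is a unitary, i.e. if its unit is not
Murray–von Neumann equivalent to a proper subprojection. -/
def IsFiniteCStarAlgebra (A : Type*) [CStarAlgebra A] : Prop :=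
  ∀ v : A, star v * v = 1 → v * star v = 1

/-- The C⋆-algebra `ℓ^∞(X)` of bounded complex functions on `X`. -/
abbrev LInfty (X : Type*) : Type _ := lp (fun _ : X => ℂ) ∞

/-- The Hilbert space `ℓ²(G × X) = ℓ²(G, ℓ²(X))`. -/
abbrev RegularSpace (G X : Type*) : Type _ := lp (fun _ : G × X => ℂ) 2

theorem memℓp_translate {G X : Type*} [Group G] (t : G) (ξ : RegularSpace G X) :
    Memℓp (fun p : G × X => ξ (t⁻¹ * p.1, p.2)) 2 := by
  have h2 : 0 < (2 : ℝ≥0∞).toReal := by norm_num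
  refine memℓp_gen ?_
  exact (((Equiv.mulLeft t⁻¹).prodCongr (Equiv.refl X)).summable_iff
    (f := fun p : G × X => ‖ξ p‖ ^ (2 : ℝ≥0∞).toReal)).2 ((lp.memℓp ξ).summable h2)

section CrossedProduct

variable (G X : Type*) [Group G] [MulAction G X]

/-- The representation `π` of `ℓ^∞(X)` on `ℓ²(G, ℓ²(X))` that is induced by the (faithful)
representation `M` of `ℓ^∞(X)` on `ℓ²(X)` by multiplication operators:
`(π(f) ξ)(s) = M(α_{s⁻¹}(f)) ξ(s)`, where `(α_s f)(x) = f(s⁻¹ x)` is the action of `G` on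
`ℓ^∞(X)`. In coordinates, `(π(f) ξ)(s, x) = f(s x) ξ(s, x)`. -/
def piRep (f : LInfty X) : RegularSpace G X →L[ℂ] RegularSpace G X :=
  lp.mapCLM 2 (fun p : G × X => f (p.1 • p.2) • ContinuousLinearMap.id ℂ ℂ) (norm_nonneg f)
    (fun p => by
      simpa [norm_smul] using lp.norm_apply_le_norm ENNReal.top_ne_zero f (p.1 • p.2))

/-- The unitary representation `λ` of `G` on `ℓ²(G, ℓ²(X))` by left translation:
`(λ_t ξ)(s) = ξ(t⁻¹ s)`. -/
def lambdaRep (t : G) : RegularSpace G X →L[ℂ] RegularSpace G X :=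
  LinearMap.mkContinuous
    { toFun := fun ξ => ⟨fun p => ξ (t⁻¹ * p.1, p.2), memℓp_translate t ξ⟩
      map_add' := fun _ _ => rfl
      map_smul' := fun _ _ => rfl }
    1
    (fun ξ => by
      have h2 : 0 < (2 : ℝ≥0∞).toReal := by norm_num
      rw [one_mul, lp.norm_eq_tsum_rpow h2, lp.norm_eq_tsum_rpow h2]
      exact le_of_eq (congrArg (· ^ (1 / (2 : ℝ≥0∞).toReal))
        (((Equiv.mulLeft t⁻¹).prodCongr (Equiv.refl X)).tsum_eq
          (fun p : G × X => ‖ξ p‖ ^ (2 : ℝ≥0∞).toReal))))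

/-- The reduced crossed product `ℓ^∞(X) ⋊_r G`: the C⋆-algebra of operators on `ℓ²(G, ℓ²(X))`
generated by the operators `π(f)`, `f ∈ ℓ^∞(X)`, and `λ_t`, `t ∈ G`, of the regular
representation. -/
def reducedCrossedProduct :
    StarSubalgebra ℂ (RegularSpace G X →L[ℂ] RegularSpace G X) :=
  (StarAlgebra.adjoin ℂ (Set.range (piRep G X) ∪ Set.range (lambdaRep G X))).topologicalClosure

instance : CStarAlgebra (reducedCrossedProduct G X) :=
  haveI : IsClosed (reducedCrossedProduct G X : Set (RegularSpace G X →L[ℂ] RegularSpace G X)) :=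
    StarSubalgebra.isClosed_topologicalClosure _
  StarSubalgebra.cstarAlgebra _

end CrossedProduct

/-- The uniform Roe algebra `ℓ^∞(G) ⋊_r G`, for the action of `G` on itself by left
translation. -/
abbrev uniformRoeAlgebra (G : Type*) [Group G] :
    StarSubalgebra ℂ (RegularSpace G G →L[ℂ] RegularSpace G G) :=
  reducedCrossedProduct G G

end UniformRoe

end

/-! The implications form a cycle 1 → 2 → 3 → 4 → 5 → 1. 1 → 2: an isometry `v` is within 1/4 of
some `a` in the algebraic crossed product. Only finitely many translations enter `a`, so it is block
diagonal along the orbits of a finite subgroup. As `a` is bounded below, it is injective on each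
finite-dimensional block, hence onto there, so its range is dense; closeness then forces `v` to be
unitary (`mul_star_self_eq_one_of_norm_sub_lt`). 2 → 3: an equidecomposition of `G` with `B` gives
the isometry `∑ λ(sᵢ) π(1_{Pᵢ})`, whose range misses the vectors over the complement of `B`. 3 → 4:
extend by the identity. 4 → 5: on the image of ℕ in an embedded ℤ, the shift is a piecewise
translation onto a proper subset. 5 → 1: an infinite finitely generated subgroup contains
arbitrarily long geodesics; centred at 1, they have a bi-infinite limit
(`exists_biinfinite_geodesic`), which embeds ℤ uniformly. -/

noncomputable section

namespace UniformRoe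

/-! ### Piecewise translations -/

section Equidecomposability

variable {G X : Type*} [Group G] [MulAction G X]

/-- An injective map on `A` that acts piecewise by finitely many group elements yields an
equidecomposition of `A` with its image. -/
theorem equidecomposable_image {A : Set X} {σ : X → X} (hσ : Set.InjOn σ A) {T : Set G}
    (hT : T.Finite) (h : ∀ a ∈ A, ∃ t ∈ T, σ a = t • a) : Equidecomposable G A (σ '' A) := by
  choose! t htT ht using h
  obtain ⟨n, ⟨e⟩⟩ := hT.exists_equiv_fin
  -- Each piece collects the points moved by one element of `T`; it may be empty.
  refine ⟨n, fun i => {a ∈ A | t a = e.symm i},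
    fun i => ((e.symm i : T) : G) • {a ∈ A | t a = e.symm i}, fun i => e.symm i,
    ?_, ?_, ?_, ?_, fun _ => rfl⟩
  · intro i j hij
    refine Set.disjoint_left.2 fun a ha hb => hij (e.symm.injective (Subtype.ext ?_))
    exact ha.2.symm.trans hb.2
  · ext a
    simp only [Set.mem_iUnion, Set.mem_ofPred_eq]
    refine ⟨fun ⟨_, ha, _⟩ => ha, fun ha => ⟨e ⟨t a, htT a ha⟩, ha, by simp⟩⟩
  · intro i j hij
    refine Set.disjoint_left.2 ?_
    rintro _ ⟨a, ⟨ha, hai⟩, rfl⟩ ⟨b, ⟨hb, hbj⟩, hab⟩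
    have hab' : a = b := by
      refine hσ ha hb ?_
      rw [ht a ha, ht b hb, hai, hbj]
      exact hab.symm
    subst hab'
    exact hij (e.symm.injective (Subtype.ext (hai.symm.trans hbj)))
  · ext y
    simp only [Set.mem_iUnion]
    constructor
    · rintro ⟨i, a, ⟨ha, hai⟩, rfl⟩
      exact ⟨a, ha, by rw [ht a ha, hai]⟩
    · rintro ⟨a, ha, rfl⟩
      refine ⟨e ⟨t a, htT a ha⟩, a, ⟨ha, by simp⟩, ?_⟩
      simp [ht a ha]

/-- An equidecomposition may be extended by the identity on the complement. -/
theorem Equidecomposable.union_compl {A B : Set X} (h : Equidecomposable G A B) (hBA : B ⊆ A) :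
    Equidecomposable G (Set.univ : Set X) (B ∪ Aᶜ) := by
  obtain ⟨n, P, Q, s, hP, hPA, hQ, hQB, hs⟩ := h
  refine ⟨n + 1, Fin.cons Aᶜ P, Fin.cons Aᶜ Q, Fin.cons 1 s, ?_, ?_, ?_, ?_, ?_⟩
  · have hd : ∀ i, Disjoint Aᶜ (P i) := fun i =>
      Set.disjoint_compl_left_iff_subset.2 (hPA ▸ Set.subset_iUnion P i)
    intro i j hij
    induction i using Fin.cases with
    | zero =>
      induction j using Fin.cases with
      | zero => exact absurd rfl hij
      | succ j => exact hd j
    | succ i =>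
      induction j using Fin.cases with
      | zero => exact (hd i).symm
      | succ j => exact hP fun h => hij (congrArg Fin.succ h)
  · ext x
    simp only [Set.mem_iUnion, Fin.exists_fin_succ, Fin.cons_zero, Fin.cons_succ, Set.mem_univ,
      iff_true, ← hPA, Set.mem_compl_iff]
    exact (em _).symm
  · have hd : ∀ i, Disjoint Aᶜ (Q i) := fun i =>
      Set.disjoint_compl_left_iff_subset.2 ((hQB ▸ Set.subset_iUnion Q i).trans hBA)
    intro i j hij
    induction i using Fin.cases with
    | zero =>
      induction j using Fin.cases with
      | zero => exact absurd rfl hij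
      | succ j => exact hd j
    | succ i =>
      induction j using Fin.cases with
      | zero => exact (hd i).symm
      | succ j => exact hQ fun h => hij (congrArg Fin.succ h)
  · ext x
    simp only [Set.mem_iUnion, Fin.exists_fin_succ, Fin.cons_zero, Fin.cons_succ, ← hQB,
      Set.mem_union]
    exact or_comm
  · intro i
    induction i using Fin.cases with
    | zero => simp
    | succ i => simpa using hs i

/-- If the whole space is not equidecomposable with a proper subset, then no subset is. -/
theorem not_equidecomposable_ssubset
    (h : ¬ ∃ B : Set X, B ⊂ Set.univ ∧ Equidecomposable G (Set.univ : Set X) B) (A : Set X) :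
    ¬ ∃ B : Set X, B ⊂ A ∧ Equidecomposable G A B := by
  rintro ⟨B, hBA, hAB⟩
  refine h ⟨B ∪ Aᶜ, ?_, hAB.union_compl hBA.subset⟩
  obtain ⟨a, haA, haB⟩ := Set.exists_of_ssubset hBA
  exact Set.ssubset_univ_iff.2 fun hu => by
    have : a ∈ B ∪ Aᶜ := hu ▸ Set.mem_univ a
    exact this.elim haB fun h => h haA

end Equidecomposability

/-! ### Bi-infinite geodesics and embeddings of ℤ -/

section Geodesics

variable {G : Type*} [Group G]

/-- The forward orbit of an injective uniform embedding of `ℤ` is equidecomposable with its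
shift. -/
theorem IsGroupUniformEmbedding.exists_equidecomposable_ssubset {f : Multiplicative ℤ → G}
    (hf : IsGroupUniformEmbedding f) (hinj : Function.Injective f) :
    ∃ A B : Set G, B ⊂ A ∧ Equidecomposable G A B := by
  obtain ⟨T, hT, hfT⟩ := hf.1 {Multiplicative.ofAdd 1} (Set.finite_singleton _)
  let g : ℕ → G := fun n => f (Multiplicative.ofAdd (n : ℤ))
  have hg : Function.Injective g := fun m n h => by
    simpa using hinj h
  let σ : G → G := fun x => g (Function.invFun g x + 1)
  have hσ : ∀ n, σ (g n) = g (n + 1) := fun n => by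
    simp only [σ, Function.leftInverse_invFun hg n]
  refine ⟨Set.range g, σ '' Set.range g, ?_, equidecomposable_image (T := T) ?_ hT ?_⟩
  · refine (Set.ssubset_iff_of_subset ?_).2 ⟨g 0, ⟨0, rfl⟩, ?_⟩
    · rintro _ ⟨_, ⟨n, rfl⟩, rfl⟩
      exact ⟨n + 1, (hσ n).symm⟩
    · rintro ⟨_, ⟨n, rfl⟩, h⟩
      rw [hσ] at h
      exact absurd (hg h) n.succ_ne_zero
  · rintro _ ⟨m, rfl⟩ _ ⟨n, rfl⟩ h
    rw [hσ, hσ] at h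
    rw [Nat.succ_injective (hg h)]
  · rintro _ ⟨n, rfl⟩
    refine ⟨g (n + 1) * (g n)⁻¹, hfT _ _ ?_, by simp [hσ]⟩
    simp [← ofAdd_neg, ← ofAdd_add]

/-- A sequence of elements of `G` whose consecutive quotients lie in `S` witnesses membership in
the powers of `S`. -/
theorem exists_path_of_mem_pow {S : Set G} (h1 : 1 ∈ S) (n : ℕ) {g : G} (hg : g ∈ S ^ n) :
    ∃ p : ℕ → G, p 0 = 1 ∧ p n = g ∧ ∀ k, p (k + 1) * (p k)⁻¹ ∈ S := by
  induction n generalizing g with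
  | zero =>
    rw [pow_zero, Set.mem_one] at hg
    exact ⟨fun _ => 1, rfl, hg.symm, fun _ => by simpa using h1⟩
  | succ n ih =>
    rw [pow_succ'] at hg
    obtain ⟨s, hs, g', hg', rfl⟩ := Set.mem_mul.1 hg
    obtain ⟨p, hp0, hpn, hp⟩ := ih hg'
    -- The path stays constant after its end, which is allowed because `1 ∈ S`.
    refine ⟨fun k => if k ≤ n then p k else s * g', by simp [hp0], by simp, fun k => ?_⟩
    rcases lt_trichotomy k n with hk | rfl | hk
    · simpa [hk.le, Nat.succ_le_of_lt hk] using hp k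
    · simpa [hpn] using hs
    · simpa [not_le.2 hk, not_le.2 (hk.trans k.lt_succ_self)] using h1

theorem mul_inv_mem_pow_of_path {S : Set G} {p : ℕ → G}
    (hp : ∀ k, p (k + 1) * (p k)⁻¹ ∈ S) (j m : ℕ) : p (j + m) * (p j)⁻¹ ∈ S ^ m := by
  induction m with
  | zero => simp
  | succ m ih =>
    rw [pow_succ']
    refine Set.mem_mul.2 ⟨_, hp (j + m), _, ih, ?_⟩
    simp [add_assoc]

theorem finite_pow {S : Set G} (hS : S.Finite) (n : ℕ) : (S ^ n).Finite := by
  induction n with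
  | zero => simp
  | succ n ih =>
    rw [pow_succ]
    exact ih.mul hS

/-- The powers of a finite symmetric set containing `1` that lies in no finite subgroup grow
strictly. -/
theorem exists_mem_pow_succ_notMem {S : Set G} (hS : S.Finite) (h1 : 1 ∈ S) (hinv : S⁻¹ = S)
    (hinf : (Subgroup.closure S : Set G).Infinite) (n : ℕ) : ∃ g ∈ S ^ (n + 1), g ∉ S ^ n := by
  by_contra! hcon
  -- Once the powers stop growing they stay inside `S ^ n`, which then contains the whole generated
  -- subgroup.
  have hstab : ∀ m, S ^ m ⊆ S ^ n := fun m => by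
    induction m with
    | zero => exact Set.pow_subset_pow_right h1 (Nat.zero_le n)
    | succ m ih =>
      rw [pow_succ']
      refine (Set.mul_subset_mul_left ih).trans ?_
      rw [← pow_succ']
      exact hcon
  refine hinf ((finite_pow hS n).subset fun g hg => ?_)
  induction hg using Subgroup.closure_induction with
  | mem x hx => exact hstab 1 (by simpa using hx)
  | one => exact hstab 0 (by simp)
  | mul x y _ _ hx hy => exact hstab (n + n) (by rw [pow_add]; exact Set.mul_mem_mul hx hy)
  | inv x _ hx =>
    rw [← Set.mem_inv, ← inv_pow, hinv]
    exact hx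

/-- The map `q` is geodesic on `[-N, N]` for the right-invariant word metric of `S`, and sends `0`
to `1`. -/
structure IsGeodesicOn (S : Set G) (N : ℤ) (q : ℤ → G) : Prop where
  zero : q 0 = 1
  mem_pow : ∀ j k, -N ≤ j → j ≤ k → k ≤ N → q k * (q j)⁻¹ ∈ S ^ (k - j).toNat
  notMem_pow : ∀ j k, -N ≤ j → j ≤ k → k ≤ N → ∀ m < (k - j).toNat, q k * (q j)⁻¹ ∉ S ^ m

/-- Take a shortest path to an element of word length exactly `2 * N`. Right multiplication by the
inverse of its midpoint moves that midpoint to 1 and changes no quotient. -/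
theorem exists_isGeodesicOn {S : Set G} (hS : S.Finite) (h1 : 1 ∈ S) (hinv : S⁻¹ = S)
    (hinf : (Subgroup.closure S : Set G).Infinite) (N : ℕ) :
    ∃ q : ℤ → G, IsGeodesicOn S N q := by
  obtain ⟨g, hg, hg'⟩ : ∃ g ∈ S ^ (2 * N), ∀ m < 2 * N, g ∉ S ^ m := by
    rcases Nat.eq_zero_or_pos N with rfl | hN
    · exact ⟨1, by simp, by simp⟩
    · obtain ⟨g, hg, hg'⟩ := exists_mem_pow_succ_notMem hS h1 hinv hinf (2 * N - 1)
      rw [Nat.sub_add_cancel (by omega)] at hg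
      exact ⟨g, hg, fun m hm h => hg' (Set.pow_subset_pow_right h1 (by omega) h)⟩
  obtain ⟨p, hp0, hpg, hp⟩ := exists_path_of_mem_pow h1 _ hg
  refine ⟨fun k => p (k + N).toNat * (p N)⁻¹, by simp, fun j k hj hjk hk => ?_,
    fun j k hj hjk hk m hm hmem => ?_⟩
  · have := mul_inv_mem_pow_of_path hp (j + N).toNat (k - j).toNat
    rw [show (j + N).toNat + (k - j).toNat = (k + N).toNat by omega] at this
    simpa [mul_assoc] using this
  · have hlow := mul_inv_mem_pow_of_path hp 0 (j + N).toNat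
    have hhigh := mul_inv_mem_pow_of_path hp (k + N).toNat (N - k).toNat
    rw [show (k + N).toNat + (N - k).toNat = 2 * N by omega, hpg] at hhigh
    rw [hp0, zero_add] at hlow
    -- A shortcut between `j` and `k` would shorten the whole path to `g`.
    refine hg' ((N - k).toNat + m + (j + N).toNat) (by omega) ?_
    rw [pow_add, pow_add]
    have := Set.mul_mem_mul (Set.mul_mem_mul hhigh hmem) hlow
    simpa [mul_assoc] using this

/-- A bi-infinite geodesic exists in each infinite finitely generated group, as a limit of finite
geodesics along an ultrafilter. -/
theorem exists_biinfinite_geodesic {S : Set G} (hS : S.Finite) (h1 : 1 ∈ S) (hinv : S⁻¹ = S)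
    (hinf : (Subgroup.closure S : Set G).Infinite) :
    ∃ c : ℤ → G, ∀ N, IsGeodesicOn S N c := by
  choose q hq using exists_isGeodesicOn hS h1 hinv hinf
  let U : Ultrafilter ℕ := Filter.hyperfilter ℕ
  have hU : ∀ M : ℕ, ∀ᶠ N in (U : Filter ℕ), M ≤ N := fun M =>
    (Nat.hyperfilter_le_atTop (Filter.eventually_ge_atTop M))
  have hlim : ∀ k : ℤ, ∃ c : G, ∀ᶠ N in (U : Filter ℕ), q N k = c := fun k => by
    -- For `N ≥ |k|` the value `q N k` lies in this finite set, so the ultrafilter selects one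
    -- value.
    have hfin : (S ^ k.natAbs ∪ (S ^ k.natAbs)⁻¹).Finite := (finite_pow hS _).union (finite_pow hS _).inv
    have : (⋃ c ∈ S ^ k.natAbs ∪ (S ^ k.natAbs)⁻¹, {N | q N k = c}) ∈ U := by
      filter_upwards [hU k.natAbs] with N hN
      simp only [Set.mem_iUnion, Set.mem_ofPred_eq, exists_prop, exists_eq_right']
      rcases le_total 0 k with hk | hk
      · left
        have := (hq N).mem_pow 0 k (by omega) hk (by omega)
        rw [(hq N).zero, show (k - 0).toNat = k.natAbs by omega] at this
        simpa using this
      · right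
        have := (hq N).mem_pow k 0 (by omega) hk (by omega)
        rw [(hq N).zero, show (0 - k).toNat = k.natAbs by omega] at this
        simpa using this
    obtain ⟨c, -, hc⟩ := (Ultrafilter.finite_biUnion_mem_iff hfin).1 this
    exact ⟨c, hc⟩
  choose c hc using hlim
  refine ⟨c, fun _ => ⟨?_, fun j k _ hjk _ => ?_, fun j k _ hjk _ => ?_⟩⟩
  · obtain ⟨N, hN⟩ := (hc 0).exists
    rw [← hN, (hq N).zero]
  -- Each condition involves only two values of `c`, so a single large `N` realises both.
  all_goals
    obtain ⟨N, hj, hk, hjN, hkN⟩ :=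
      ((hc j).and ((hc k).and ((hU j.natAbs).and (hU k.natAbs)))).exists
    rw [← hj, ← hk]
  · exact (hq N).mem_pow j k (by omega) hjk (by omega)
  · exact (hq N).notMem_pow j k (by omega) hjk (by omega)

/-- A bi-infinite geodesic is an injective uniform embedding of `ℤ`. -/
theorem injective_isGroupUniformEmbedding_of_geodesic {S : Set G} (hS : S.Finite) (h1 : 1 ∈ S)
    {c : ℤ → G} (hc : ∀ N, IsGeodesicOn S N c) :
    Function.Injective (fun x : Multiplicative ℤ => c x.toAdd) ∧
      IsGroupUniformEmbedding (fun x : Multiplicative ℤ => c x.toAdd) := by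
  have hmem : ∀ j k, j ≤ k → c k * (c j)⁻¹ ∈ S ^ (k - j).toNat := fun j k hjk =>
    (hc (max |j| |k|)).mem_pow j k (by grind) hjk (by grind)
  have hnot : ∀ j k, j ≤ k → ∀ m < (k - j).toNat, c k * (c j)⁻¹ ∉ S ^ m := fun j k hjk =>
    (hc (max |j| |k|)).notMem_pow j k (by grind) hjk (by grind)
  refine ⟨?_, fun F hF => ?_, fun T hT => ?_⟩
  · have key : ∀ j k, j < k → c j ≠ c k := fun j k hjk h =>
      hnot j k hjk.le 0 (by omega) (by simp [h])
    intro x y hxy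
    rcases lt_trichotomy x.toAdd y.toAdd with h | h | h
    · exact absurd hxy (key _ _ h)
    · exact Multiplicative.toAdd.injective h
    · exact absurd hxy.symm (key _ _ h)
  · refine ⟨⋃ z ∈ F, (S ^ z.toAdd.natAbs ∪ (S ^ z.toAdd.natAbs)⁻¹),
      hF.biUnion fun z _ => (finite_pow hS _).union (finite_pow hS _).inv, fun x y hxy => ?_⟩
    refine Set.mem_biUnion hxy ?_
    rw [toAdd_mul, toAdd_inv]
    rcases le_total y.toAdd x.toAdd with h | h
    · left
      have := hmem _ _ h
      rwa [show (x.toAdd - y.toAdd).toNat = (x.toAdd + -y.toAdd).natAbs by omega] at this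
    · right
      have := hmem _ _ h
      rw [show (y.toAdd - x.toAdd).toNat = (x.toAdd + -y.toAdd).natAbs by omega] at this
      simpa using this
  -- `T` may contain elements in no power of `S`; only the others need a common bound.
  · have hbound : ∀ T : Set G, T.Finite → ∃ M, ∀ t ∈ T, ∀ m, t ∈ S ^ m → t ∈ S ^ M := by
      intro T hT
      induction T, hT using Set.Finite.induction_on with
      | empty => exact ⟨0, by simp⟩
      | @insert a T _ _ ih =>
        obtain ⟨M, hM⟩ := ih
        by_cases ha : ∃ m, a ∈ S ^ m
        · obtain ⟨m, hm⟩ := ha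
          refine ⟨max m M, ?_⟩
          rintro t (rfl | ht) k hk
          · exact Set.pow_subset_pow_right h1 (le_max_left _ _) hm
          · exact Set.pow_subset_pow_right h1 (le_max_right _ _) (hM t ht k hk)
        · refine ⟨M, ?_⟩
          rintro t (rfl | ht) k hk
          · exact absurd ⟨k, hk⟩ ha
          · exact hM t ht k hk
    obtain ⟨M, hM⟩ := hbound (T ∪ T⁻¹) (hT.union hT.inv)
    have key : ∀ j k, j ≤ k → c k * (c j)⁻¹ ∈ T ∪ T⁻¹ → k - j ≤ M := fun j k hjk h => by
      by_contra hlt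
      exact hnot j k hjk M (by omega) (hM _ h _ (hmem j k hjk))
    refine ⟨Multiplicative.toAdd ⁻¹' Set.Icc (-(M : ℤ)) M,
      (Set.finite_Icc _ _).preimage Multiplicative.toAdd.injective.injOn, fun x y hxy => ?_⟩
    simp only [Set.mem_preimage, toAdd_mul, toAdd_inv, Set.mem_Icc]
    rcases le_total y.toAdd x.toAdd with h | h
    · have := key _ _ h (Or.inl hxy)
      omega
    · have := key _ _ h (Or.inr (by simpa using hxy))
      omega

/-- A group that is not locally finite contains a uniformly embedded copy of `ℤ`. -/
theorem exists_uniformEmbedding_of_not_locallyFinite (h : ¬ IsLocallyFiniteGroup G) :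
    ∃ f : Multiplicative ℤ → G, Function.Injective f ∧ IsGroupUniformEmbedding f := by
  simp only [IsLocallyFiniteGroup, not_forall] at h
  obtain ⟨H, ⟨T, rfl⟩, hinf⟩ := h
  let S : Set G := insert 1 ((T : Set G) ∪ (T : Set G)⁻¹)
  have hS : S.Finite := (T.finite_toSet.union T.finite_toSet.inv).insert 1
  have h1 : (1 : G) ∈ S := Set.mem_insert _ _
  have hinv : S⁻¹ = S := by
    simp [S, Set.inv_insert, Set.union_comm]
  have hsub : (T : Set G) ⊆ S := fun x hx => Or.inr (Or.inl hx)
  obtain ⟨c, hc⟩ := exists_biinfinite_geodesic hS h1 hinv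
    (Set.Infinite.mono (Subgroup.closure_mono hsub) hinf)
  exact ⟨_, injective_isGroupUniformEmbedding_of_geodesic hS h1 hc⟩

end Geodesics

/-! ### Isometries from equidecompositions -/

section CrossedProductOperators

variable {G X : Type*} [Group G]

theorem lambdaRep_apply (t : G) (ξ : RegularSpace G X) (p : G × X) :
    lambdaRep G X t ξ p = ξ (t⁻¹ * p.1, p.2) := rfl

theorem star_lambdaRep (t : G) : star (lambdaRep G X t) = lambdaRep G X t⁻¹ := by
  rw [ContinuousLinearMap.star_eq_adjoint, eq_comm, ContinuousLinearMap.eq_adjoint_iff]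
  intro ξ η
  rw [lp.inner_eq_tsum, lp.inner_eq_tsum,
    ← ((Equiv.mulLeft t⁻¹).prodCongr (Equiv.refl X)).tsum_eq]
  refine tsum_congr fun p => ?_
  simp only [lambdaRep_apply, inv_inv]
  simp [Prod.map]

variable [MulAction G X]

theorem piRep_apply (f : LInfty X) (ξ : RegularSpace G X) (p : G × X) :
    piRep G X f ξ p = f (p.1 • p.2) * ξ p := rfl

theorem star_piRep (f : LInfty X) : star (piRep G X f) = piRep G X (star f) := by
  rw [ContinuousLinearMap.star_eq_adjoint, eq_comm, ContinuousLinearMap.eq_adjoint_iff]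
  intro ξ η
  rw [lp.inner_eq_tsum, lp.inner_eq_tsum]
  refine tsum_congr fun p => ?_
  simp only [piRep_apply, lp.star_apply, RCLike.inner_apply, map_mul, RCLike.star_def,
    RCLike.conj_conj]
  ring

/-- The indicator function of a set, as a bounded function. -/
def indicatorLInfty (A : Set X) : LInfty X :=
  ⟨A.indicator 1, memℓp_infty ⟨1, by
    rintro _ ⟨x, rfl⟩
    by_cases hx : x ∈ A <;> simp [hx]⟩⟩

theorem indicatorLInfty_apply (A : Set X) (x : X) :
    indicatorLInfty A x = A.indicator (1 : X → ℂ) x := rfl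

variable (G X) in
theorem piRep_mem (f : LInfty X) : piRep G X f ∈ reducedCrossedProduct G X :=
  StarSubalgebra.le_topologicalClosure _ (StarAlgebra.subset_adjoin ℂ _ (Or.inl ⟨f, rfl⟩))

variable (G X) in
theorem lambdaRep_mem (t : G) : lambdaRep G X t ∈ reducedCrossedProduct G X :=
  StarSubalgebra.le_topologicalClosure _ (StarAlgebra.subset_adjoin ℂ _ (Or.inr ⟨t, rfl⟩))

/-- The operator that moves the piece `P i` by `s i`. -/
def pieceOperator {n : ℕ} (P : Fin n → Set X) (s : Fin n → G) :
    RegularSpace G X →L[ℂ] RegularSpace G X :=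
  ∑ i, lambdaRep G X (s i) * piRep G X (indicatorLInfty (P i))

theorem pieceOperator_mem {n : ℕ} (P : Fin n → Set X) (s : Fin n → G) :
    pieceOperator P s ∈ reducedCrossedProduct G X :=
  sum_mem fun _ _ => mul_mem (lambdaRep_mem G X _) (piRep_mem G X _)

/-- Translation by `s i` carries the indicator of `P i` to that of `s i • P i`. -/
theorem pieceOperator_apply {n : ℕ} (P : Fin n → Set X) (s : Fin n → G) (ξ : RegularSpace G X)
    (p : G × X) : pieceOperator P s ξ p =
      ∑ i, (s i • P i).indicator 1 (p.1 • p.2) * ξ ((s i)⁻¹ * p.1, p.2) := by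
  simp only [pieceOperator, sum_apply, lp.coeFn_sum, Finset.sum_apply,
    mul_apply_eq_comp, lambdaRep_apply, piRep_apply, indicatorLInfty_apply]
  refine Finset.sum_congr rfl fun i _ => congrArg (· * _) ?_
  classical
  rw [Set.indicator_apply, Set.indicator_apply]
  refine if_congr ?_ rfl rfl
  rw [Set.mem_smul_set_iff_inv_smul_mem, mul_smul]

theorem star_indicatorLInfty (A : Set X) : star (indicatorLInfty A) = indicatorLInfty A := by
  ext x
  by_cases hx : x ∈ A <;> simp [lp.star_apply, indicatorLInfty_apply, hx]

theorem star_pieceOperator_apply {n : ℕ} (P : Fin n → Set X) (s : Fin n → G)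
    (ξ : RegularSpace G X) (p : G × X) : star (pieceOperator P s) ξ p =
      ∑ i, (P i).indicator 1 (p.1 • p.2) * ξ (s i * p.1, p.2) := by
  simp only [pieceOperator, star_sum, star_mul, star_piRep, star_lambdaRep, star_indicatorLInfty,
    sum_apply, lp.coeFn_sum, Finset.sum_apply,
    mul_apply_eq_comp, lambdaRep_apply, piRep_apply, indicatorLInfty_apply, inv_inv]

/-- For an equidecomposition of the whole space, the associated operator is an isometry. -/
theorem star_pieceOperator_mul_self {n : ℕ} {P : Fin n → Set X} {s : Fin n → G}
    (hP : Pairwise fun i j => Disjoint (P i) (P j)) (hPu : (⋃ i, P i) = Set.univ)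
    (hQ : Pairwise fun i j => Disjoint (s i • P i) (s j • P j)) :
    star (pieceOperator P s) * pieceOperator P s = 1 := by
  ext ξ p
  -- Only the piece `P i` containing `p.1 • p.2` contributes: `hP` removes the other terms of the
  -- outer sum, `hQ` those of the inner one.
  obtain ⟨i, hi⟩ := Set.mem_iUnion.1 (hPu ▸ Set.mem_univ (p.1 • p.2))
  have hQi : (s i * p.1) • p.2 ∈ s i • P i := by
    rw [mul_smul]
    exact Set.smul_mem_smul_set hi
  rw [mul_apply_eq_comp, star_pieceOperator_apply, Finset.sum_eq_single i,
    pieceOperator_apply, Finset.sum_eq_single i]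
  · simp [hi, hQi]
  · intro j _ hj
    rw [Set.indicator_of_notMem (Set.disjoint_right.1 (hQ hj) hQi), zero_mul]
  · simp
  · intro j _ hj
    rw [Set.indicator_of_notMem (Set.disjoint_right.1 (hP hj) hi), zero_mul]
  · simp

/-- If the crossed product is finite then `X` is not equidecomposable with a proper subset. -/
theorem not_equidecomposable_of_isFiniteCStarAlgebra
    (h : IsFiniteCStarAlgebra (reducedCrossedProduct G X)) :
    ¬ ∃ B : Set X, B ⊂ Set.univ ∧ Equidecomposable G (Set.univ : Set X) B := by
  classical
  rintro ⟨B, hB, n, P, Q, s, hP, hPu, hQ, hQB, hs⟩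
  obtain rfl : Q = fun i => s i • P i := funext hs
  obtain ⟨x, -, hx⟩ := Set.exists_of_ssubset hB
  have hv := congrArg Subtype.val
    (h ⟨pieceOperator P s, pieceOperator_mem P s⟩
      (Subtype.ext (star_pieceOperator_mul_self hP hPu hQ)))
  have hv' : pieceOperator P s * star (pieceOperator P s) = 1 := hv
  -- Evaluate at the basis vector of `(1, x)` with `x ∉ B`: no translated piece contains `x`, so the
  -- left side vanishes there.
  have h1 := congrArg (fun T : RegularSpace G X →L[ℂ] RegularSpace G X =>
    T (lp.single 2 ((1 : G), x) (1 : ℂ)) (1, x)) hv'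
  simp only [mul_apply_eq_comp, one_apply_eq_self,
    lp.single_apply_self] at h1
  rw [pieceOperator_apply, Finset.sum_eq_zero] at h1
  · exact zero_ne_one h1
  · intro i _
    rw [Set.indicator_of_notMem, zero_mul]
    intro hi
    rw [one_smul] at hi
    exact hx (hQB ▸ Set.mem_iUnion.2 ⟨i, hi⟩)

end CrossedProductOperators

/-! ### Finiteness for locally finite groups -/

section LocallyFinite

/-- An operator that is close to an operator with dense range and is an isometry is unitary. -/
theorem mul_star_self_eq_one_of_norm_sub_lt {E : Type*} [NormedAddCommGroup E]
    [InnerProductSpace ℂ E] [CompleteSpace E] {v a : E →L[ℂ] E} (hv : star v * v = 1)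
    (hva : ‖v - a‖ < 1 / 4) (ha : a.range.topologicalClosure = ⊤) : v * star v = 1 := by
  have hnorm : ∀ ξ, ‖v ξ‖ = ‖ξ‖ :=
    (ContinuousLinearMap.norm_map_iff_adjoint_comp_self v).2 hv
  have hker : ∀ η, star v η = 0 → η = 0 := by
    intro η hη
    -- `η` is orthogonal to the range of `v`, hence nearly so to that of `a`: the error `‖ξ‖ / 4` is
    -- at most half of `‖a ξ‖ ≥ 3 / 4 * ‖ξ‖`. By density `ζ = η` is allowed, which forces `η = 0`.
    have hsmall : ∀ ζ ∈ a.range.topologicalClosure, ‖inner ℂ η ζ‖ ≤ 1 / 2 * ‖η‖ * ‖ζ‖ := by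
      have hcl : IsClosed {ζ : E | ‖inner ℂ η ζ‖ ≤ 1 / 2 * ‖η‖ * ‖ζ‖} :=
        isClosed_le (by fun_prop) (by fun_prop)
      refine fun ζ hζ => closure_minimal (t := {ζ : E | ‖inner ℂ η ζ‖ ≤ 1 / 2 * ‖η‖ * ‖ζ‖})
        ?_ hcl hζ
      rintro _ ⟨ξ, rfl⟩
      have hd : ‖(v - a) ξ‖ ≤ 1 / 4 * ‖ξ‖ := ((v - a).le_opNorm ξ).trans (by gcongr)
      have hb : 3 / 4 * ‖ξ‖ ≤ ‖a ξ‖ := by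
        have := norm_sub_norm_le (v ξ) (a ξ)
        rw [hnorm] at this
        rw [sub_apply] at hd
        linarith
      have hin : inner ℂ η (a ξ) = - inner ℂ η ((v - a) ξ) := by
        have : inner ℂ η (v ξ) = 0 := by
          rw [← ContinuousLinearMap.adjoint_inner_left, ← ContinuousLinearMap.star_eq_adjoint, hη,
            inner_zero_left]
        rw [sub_apply, inner_sub_right, this]
        ring
      show ‖inner ℂ η (a ξ)‖ ≤ 1 / 2 * ‖η‖ * ‖a ξ‖
      rw [hin, norm_neg]
      calc _ ≤ ‖η‖ * ‖(v - a) ξ‖ := norm_inner_le_norm _ _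
        _ ≤ ‖η‖ * (1 / 2 * ‖a ξ‖) := by gcongr; linarith [norm_nonneg ξ]
        _ = _ := by ring
    have := hsmall η (ha ▸ Submodule.mem_top)
    rw [inner_self_eq_norm_sq_to_K, norm_pow, RCLike.norm_ofReal, abs_norm] at this
    have h0 : ‖η‖ = 0 := by nlinarith [norm_nonneg η]
    exact norm_eq_zero.1 h0
  ext ζ
  rw [one_apply_eq_self, ← sub_eq_zero]
  refine hker _ ?_
  rw [map_sub, ← mul_apply_eq_comp, ← mul_assoc, hv, one_mul, sub_self]

variable {G X : Type*}

/-- The vectors that are supported in `C`. -/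
def supportedIn (C : Set (G × X)) : Submodule ℂ (RegularSpace G X) where
  carrier := {ξ | ∀ p ∉ C, ξ p = 0}
  add_mem' hξ hη p hp := by simp [hξ p hp, hη p hp]
  zero_mem' _ _ := rfl
  smul_mem' c ξ hξ p hp := by simp [hξ p hp]

theorem finiteDimensional_supportedIn {C : Set (G × X)} (hC : C.Finite) :
    FiniteDimensional ℂ (supportedIn C) := by
  have := hC.to_subtype
  let r : supportedIn C →ₗ[ℂ] (C → ℂ) :=
    { toFun := fun ξ p => ξ.1 p.1
      map_add' := fun _ _ => rfl
      map_smul' := fun _ _ => rfl }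
  refine FiniteDimensional.of_injective r fun ξ η h => Subtype.ext (lp.ext (funext fun p => ?_))
  by_cases hp : p ∈ C
  · exact congrFun h ⟨p, hp⟩
  · rw [ξ.2 p hp, η.2 p hp]

variable [Group G]

/-- A set that is invariant under left translation by `H` in the first coordinate. -/
def IsTranslationInvariant (H : Subgroup G) (C : Set (G × X)) : Prop :=
  ∀ h ∈ H, ∀ p : G × X, (h * p.1, p.2) ∈ C ↔ p ∈ C

theorem IsTranslationInvariant.compl {H : Subgroup G} {C : Set (G × X)}
    (hC : IsTranslationInvariant H C) : IsTranslationInvariant H Cᶜ :=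
  fun h hh p => not_congr (hC h hh p)

theorem IsTranslationInvariant.mono {H K : Subgroup G} (hHK : H ≤ K) {C : Set (G × X)}
    (hC : IsTranslationInvariant K C) : IsTranslationInvariant H C :=
  fun h hh p => hC h (hHK hh) p

/-- The operator `a` is block diagonal with respect to the `H`-orbits. -/
def IsBlockDiagonal (H : Subgroup G) (a : RegularSpace G X →L[ℂ] RegularSpace G X) : Prop :=
  ∀ C : Set (G × X), IsTranslationInvariant H C → ∀ ξ ∈ supportedIn C, a ξ ∈ supportedIn C

theorem IsBlockDiagonal.mono {H K : Subgroup G} (hHK : H ≤ K)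
    {a : RegularSpace G X →L[ℂ] RegularSpace G X} (ha : IsBlockDiagonal H a) :
    IsBlockDiagonal K a :=
  fun C hC => ha C (hC.mono hHK)

/-- For `p ∉ C` the coordinate of `star a ξ` at `p` is `⟨a δ_p, ξ⟩`, and `a δ_p` is supported in the
complement of `C`, which is again invariant. -/
theorem IsBlockDiagonal.star {H : Subgroup G} {a : RegularSpace G X →L[ℂ] RegularSpace G X}
    (ha : IsBlockDiagonal H a) : IsBlockDiagonal H (star a) := by
  classical
  intro C hC ξ hξ p hp
  have hs : lp.single 2 p (1 : ℂ) ∈ supportedIn (G := G) (X := X) Cᶜ := fun q hq =>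
    lp.single_apply_ne 2 p _ (by rintro rfl; exact hq hp)
  have hinner : inner ℂ (lp.single 2 p (1 : ℂ)) (Star.star a ξ) = (0 : ℂ) := by
    rw [ContinuousLinearMap.star_eq_adjoint, ContinuousLinearMap.adjoint_inner_right,
      lp.inner_eq_tsum]
    refine (tsum_congr fun q => ?_).trans tsum_zero
    by_cases hq : q ∈ C
    · rw [ha _ hC.compl _ hs q (fun h => h hq), inner_zero_left]
    · rw [hξ q hq, inner_zero_right]
  simpa [lp.inner_single_left] using hinner

/-- An injective operator that is block diagonal for a finite subgroup has dense range. -/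
theorem IsBlockDiagonal.topologicalClosure_range_eq_top {H : Subgroup G}
    (hH : (H : Set G).Finite) {a : RegularSpace G X →L[ℂ] RegularSpace G X}
    (ha : IsBlockDiagonal H a) (hinj : Function.Injective a) :
    a.range.topologicalClosure = ⊤ := by
  classical
  have hsingle : ∀ (p : G × X) (z : ℂ), lp.single 2 p z ∈ a.range := by
    intro p z
    -- The orbit of `p` is finite, so on vectors supported there injectivity gives surjectivity.
    let C : Set (G × X) := (fun h => (h * p.1, p.2)) '' (H : Set G)
    have hC : IsTranslationInvariant H C := by
      intro h hh q
      constructor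
      · rintro ⟨k, hk, hkq⟩
        refine ⟨h⁻¹ * k, mul_mem (inv_mem hh) hk, ?_⟩
        simp only [Prod.ext_iff] at hkq ⊢
        exact ⟨by rw [mul_assoc, hkq.1, inv_mul_cancel_left], hkq.2⟩
      · rintro ⟨k, hk, rfl⟩
        exact ⟨h * k, mul_mem hh hk, by simp [mul_assoc]⟩
    have hfin := finiteDimensional_supportedIn (hH.image fun h => (h * p.1, p.2))
    let b : supportedIn C →ₗ[ℂ] supportedIn C :=
      (a : RegularSpace G X →ₗ[ℂ] RegularSpace G X).restrict (ha C hC)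
    have hb : Function.Injective b := fun ξ η h =>
      Subtype.ext (hinj (congrArg Subtype.val h))
    have hp : lp.single 2 p z ∈ supportedIn C := fun q hq =>
      lp.single_apply_ne 2 p _ (by rintro rfl; exact hq ⟨1, one_mem H, by simp⟩)
    obtain ⟨ξ, hξ⟩ := LinearMap.surjective_of_injective hb ⟨_, hp⟩
    exact ⟨ξ, congrArg Subtype.val hξ⟩
  refine (Submodule.eq_top_iff' ).2 fun η => ?_
  exact a.range.isClosed_topologicalClosure.mem_of_tendsto
    (lp.hasSum_single (by norm_num) η)
    (Filter.Eventually.of_forall fun s =>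
      a.range.le_topologicalClosure (sum_mem fun p _ => hsingle p _))

variable [MulAction G X]

/-- Each element of the algebraic crossed product is block diagonal for a finitely generated
subgroup. -/
theorem exists_isBlockDiagonal_of_mem_adjoin {a : RegularSpace G X →L[ℂ] RegularSpace G X}
    (ha : a ∈ StarAlgebra.adjoin ℂ (Set.range (piRep G X) ∪ Set.range (lambdaRep G X))) :
    ∃ H : Subgroup G, H.FG ∧ IsBlockDiagonal H a := by
  induction ha using StarAlgebra.adjoin_induction with
  | mem x hx =>
    rcases hx with ⟨f, rfl⟩ | ⟨t, rfl⟩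
    · exact ⟨⊥, Subgroup.FG.bot, fun C _ ξ hξ p hp => by rw [piRep_apply, hξ p hp, mul_zero]⟩
    · refine ⟨Subgroup.zpowers t, ⟨{t}, by simp [Subgroup.zpowers_eq_closure]⟩,
        fun C hC ξ hξ p hp => ?_⟩
      rw [lambdaRep_apply]
      exact hξ _ fun h => hp ((hC t⁻¹ (inv_mem (Subgroup.mem_zpowers t)) p).1 h)
  | algebraMap r =>
    exact ⟨⊥, Subgroup.FG.bot, fun C _ ξ hξ => by
      simpa [Algebra.algebraMap_eq_smul_one] using Submodule.smul_mem _ r hξ⟩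
  | add x y _ _ hx hy =>
    obtain ⟨H, hH, hHx⟩ := hx
    obtain ⟨K, hK, hKy⟩ := hy
    exact ⟨H ⊔ K, hH.sup hK, fun C hC ξ hξ =>
      add_mem (hHx.mono le_sup_left C hC ξ hξ) (hKy.mono le_sup_right C hC ξ hξ)⟩
  | mul x y _ _ hx hy =>
    obtain ⟨H, hH, hHx⟩ := hx
    obtain ⟨K, hK, hKy⟩ := hy
    exact ⟨H ⊔ K, hH.sup hK, fun C hC ξ hξ =>
      hHx.mono le_sup_left C hC _ (hKy.mono le_sup_right C hC ξ hξ)⟩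
  | star x _ hx =>
    obtain ⟨H, hH, hHx⟩ := hx
    exact ⟨H, hH, hHx.star⟩

/-- The reduced crossed product by a locally finite group is finite. -/
theorem IsLocallyFiniteGroup.isFiniteCStarAlgebra (hG : IsLocallyFiniteGroup G) :
    IsFiniteCStarAlgebra (reducedCrossedProduct G X) := by
  rintro ⟨v, hvmem⟩ hv
  have hv' : star v * v = 1 := congrArg Subtype.val hv
  refine Subtype.ext (show v * star v = 1 from ?_)
  obtain ⟨a, ha, hva⟩ := Metric.mem_closure_iff.1 hvmem (1 / 4) (by norm_num)
  rw [dist_eq_norm] at hva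
  obtain ⟨H, hH, hHa⟩ := exists_isBlockDiagonal_of_mem_adjoin ha
  refine mul_star_self_eq_one_of_norm_sub_lt hv' hva
    (hHa.topologicalClosure_range_eq_top (hG H hH) ?_)
  -- If `a ξ = 0` then `‖ξ‖ = ‖(v - a) ξ‖ ≤ ‖ξ‖ / 4`.
  refine (injective_iff_map_eq_zero a).2 fun ξ hξ => ?_
  have hnorm : ‖v ξ‖ = ‖ξ‖ :=
    (ContinuousLinearMap.norm_map_iff_adjoint_comp_self v).2 hv' ξ
  have hd := (v - a).le_of_opNorm_le hva.le ξ
  rw [sub_apply, hξ, sub_zero, hnorm] at hd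
  exact norm_eq_zero.1 (by linarith [norm_nonneg ξ])

end LocallyFinite

end UniformRoe

end

theorem proposition2p5 (G : Type*) [Group G] :
    List.TFAE [
      UniformRoe.IsLocallyFiniteGroup G,
      UniformRoe.IsFiniteCStarAlgebra (UniformRoe.uniformRoeAlgebra G),
      ¬ ∃ B : Set G, B ⊂ Set.univ ∧ UniformRoe.Equidecomposable G (Set.univ : Set G) B,
      ∀ A : Set G, ¬ ∃ B : Set G, B ⊂ A ∧ UniformRoe.Equidecomposable G A B,
      ¬ ∃ f : Multiplicative ℤ → G,
        Function.Injective f ∧ UniformRoe.IsGroupUniformEmbedding f] := by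
  tfae_have 1 → 2 := UniformRoe.IsLocallyFiniteGroup.isFiniteCStarAlgebra
  tfae_have 2 → 3 := UniformRoe.not_equidecomposable_of_isFiniteCStarAlgebra
  tfae_have 3 → 4 := UniformRoe.not_equidecomposable_ssubset
  tfae_have 4 → 5 := by
    rintro h ⟨f, hinj, hf⟩
    obtain ⟨A, hA⟩ := hf.exists_equidecomposable_ssubset hinj
    exact h A hA
  tfae_have 5 → 1 := fun h =>
    by_contra fun hG => h (UniformRoe.exists_uniformEmbedding_of_not_locallyFinite hG)
  tfae_finish
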